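/- Let $(M_p)_{p\ge 0}$ be a sequence of positive real numbers with $M_0=1$ that is logarithmically convex, i.e. $M_p^2\le M_{p-1}M_{p+1}$ for every $p\ge 1$, and suppose that its quotients $m_p:=M_{p+1}/M_p$ $(p\ge 0)$ satisfy $\lim_{p\to\infty}m_p=\infty$. Put $$M(t):=\sup_{p\ge 0}\log\frac{t^p}{M_p}\quad(t>0),\qquad d_{\mathbb M}(t):=\frac{\log M(t)}{\log t}\quad(t\text{ large}),\qquad \omega(\mathbb M):=\liminf_{p\to\infty}\frac{\log m_p}{\log p}\in[0,\infty].$$ A real function $\rho$ on a half-line $(c,\infty)$, $c\ge 0$, is called a *proximate order* if 1. $\rho$ is continuous and piecewise continuously differentiable on $(c,\infty)$, that is, it is continuously differentiable off a set of points that is finite (possibly empty) or forms a sequence tending to infinity, and at each of these points it has distinct finite lateral derivatives; 2. $\rho(r)\ge 0$ for every $r>c$; 3. $\lim_{r\to\infty}\rho(r)$ exists and is finite; 4. $\lim_{r\to\infty} r\,\rho'(r)\log r=0$, where $r\to\infty$ through the points at which $\rho$ is differentiable. We say that $d_{\mathbb M}$ is a proximate order if it is one on some half-line $(c,\infty)$,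 $c\ge 1$, on which $M(t)>0$. A sequence $(s_p)_{p\ge0}$ of positive numbers is called *regularly varying* if for every $\lambda>0$ the limit $\psi(\lambda)=\lim_{p\to\infty}s_{\lfloor\lambda p\rfloor}/s_p$ exists in $(0,\infty)$; it has *index* $\omega\in\mathbb R$ if moreover $\psi(\lambda)=\lambda^{\omega}$ for every $\lambda>0$. Then the following are equivalent: (a) $d_{\mathbb M}$ is a proximate order and $\lim_{t\to\infty}d_{\mathbb M}(t)\in(0,\infty)$. (b) The limit $\lim_{p\to\infty}\log\bigl(m_p/M_p^{1/p}\bigr)$ exists and lies in $(0,\infty)$. (c) The sequence $(m_p)_{p\ge 0}$ is regularly varying with a positive index. (d) There is $\omega>0$ such that $\displaystyle\lim_{p\to\infty}\frac{m_{\ell p}}{m_p}=\ell^{\omega}$ for every integer $\ell\ge 2$. If any of these conditions holds, then $\omega(\mathbb M)\in(0,\infty)$; the limit in (b), the index in (c) and the constant $\omega$ in (d) are all equal to $\omega(\mathbb M)$; and $\lim_{t\to\infty}d_{\mathbb M}(t)=1/\omega(\mathbb M)$. -/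

import Mathlib

open Filter Topology

noncomputable section

namespace ProximateOrders

/-- The sequence of quotients `m_p = M_{p+1} / M_p`. -/
def quot (M : ℕ → ℝ) (p : ℕ) : ℝ := M (p + 1) / M p

/-- Logarithmic convexity: `M_p ^ 2 ≤ M_{p-1} M_{p+1}` for every `p ≥ 1`. -/
def IsLogConvex (M : ℕ → ℝ) : Prop := ∀ p : ℕ, 1 ≤ p → M p ^ 2 ≤ M (p - 1) * M (p + 1)

/-- The associated function `M(t) = sup_p log (t ^ p / M_p)`, for `t > 0`.
When the quotients tend to infinity the supremum is finite, see `bddAbove_assocFun`. -/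
def assocFun (M : ℕ → ℝ) (t : ℝ) : ℝ := ⨆ p : ℕ, Real.log (t ^ p / M p)

theorem bddAbove_assocFun (M : ℕ → ℝ) (hpos : ∀ p, 0 < M p)
    (hm : Tendsto (quot M) atTop atTop) (t : ℝ) (ht : 0 < t) :
    BddAbove (Set.range fun p : ℕ => Real.log (t ^ p / M p)) := by
  obtain ⟨N, hN⟩ := eventually_atTop.1 (hm.eventually_ge_atTop t)
  have key : ∀ p, N ≤ p → Real.log (t ^ p / M p) ≤ Real.log (t ^ N / M N) := by
    intro p hp
    induction p, hp using Nat.le_induction with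
    | base => exact le_rfl
    | succ p hp ih =>
      refine le_trans (Real.log_le_log (div_pos (pow_pos ht _) (hpos _)) ?_) ih
      have h := hN p hp
      rw [quot, le_div_iff₀ (hpos p)] at h
      rw [div_le_div_iff₀ (hpos _) (hpos _), pow_succ, mul_assoc]
      exact mul_le_mul_of_nonneg_left h (pow_pos ht p).le
  have hb : IsBoundedUnder (· ≤ ·) atTop fun p : ℕ => Real.log (t ^ p / M p) :=
    ⟨_, eventually_map.2 (eventually_atTop.2 ⟨N, key⟩)⟩
  exact hb.bddAbove_range

/-- The function `d_M(t) = log M(t) / log t`, meaningful for `t > 1` with `M(t) > 0`. -/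
def dFun (M : ℕ → ℝ) (t : ℝ) : ℝ := Real.log (assocFun M t) / Real.log t

/-- The index `ω(M) = liminf_p log m_p / log p`, with values in `[-∞, ∞]`. -/
def omegaIndex (M : ℕ → ℝ) : EReal :=
  liminf (fun p : ℕ => ((Real.log (quot M p) / Real.log p : ℝ) : EReal)) atTop

/-- `β_p = log (m_p / M_p ^ (1 / p))`, for `p ≥ 1`. -/
def beta (M : ℕ → ℝ) (p : ℕ) : ℝ := Real.log (quot M p / M p ^ (1 / (p : ℝ)))

/-- Continuous and piecewise continuously differentiable on `(c, ∞)`: there is a set `S` of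
exceptional points, with finitely many points in each bounded interval (so `S` is finite or a
sequence tending to infinity), such that `f` is continuously differentiable off `S` and has
distinct finite lateral derivatives at each point of `S`. -/
def IsPiecewiseC1 (f : ℝ → ℝ) (c : ℝ) : Prop :=
  ContinuousOn f (Set.Ioi c) ∧
  ∃ S : Set ℝ, S ⊆ Set.Ioi c ∧ (∀ R : ℝ, (S ∩ Set.Iic R).Finite) ∧
    (∀ r ∈ Set.Ioi c \ S, DifferentiableAt ℝ f r) ∧
    ContinuousOn (deriv f) (Set.Ioi c \ S) ∧
    ∀ r ∈ S, ∃ a b : ℝ, a ≠ b ∧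
      HasDerivWithinAt f a (Set.Iio r) r ∧ HasDerivWithinAt f b (Set.Ioi r) r

/-- `f`, considered on `(c, ∞)`, is a proximate order. In the last condition `r` tends to infinity
through the points at which `f` is differentiable. -/
structure IsProximateOrderOn (f : ℝ → ℝ) (c : ℝ) : Prop where
  left_nonneg : 0 ≤ c
  piecewise : IsPiecewiseC1 f c
  nonneg : ∀ r, c < r → 0 ≤ f r
  has_limit : ∃ L : ℝ, Tendsto f atTop (𝓝 L)
  deriv_limit : Tendsto (fun r => r * deriv f r * Real.log r)
    (atTop ⊓ 𝓟 {r | DifferentiableAt ℝ f r}) (𝓝 0)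

/-- `d_M` is a proximate order on some half-line `(c, ∞)` on which it is well defined. -/
def DIsProximateOrder (M : ℕ → ℝ) : Prop :=
  ∃ c : ℝ, 1 ≤ c ∧ (∀ t, c < t → 0 < assocFun M t) ∧ IsProximateOrderOn (dFun M) c

/-- `s_{⌊λ p⌋} / s_p → ψ(λ) ∈ (0, ∞)` for every `λ > 0`. -/
def HasVariation (s : ℕ → ℝ) (ψ : ℝ → ℝ) : Prop :=
  ∀ x : ℝ, 0 < x → 0 < ψ x ∧ Tendsto (fun p : ℕ => s ⌊x * p⌋₊ / s p) atTop (𝓝 (ψ x))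

/-- A regularly varying sequence of positive numbers. -/
def IsRegularlyVarying (s : ℕ → ℝ) : Prop := (∀ p, 0 < s p) ∧ ∃ ψ : ℝ → ℝ, HasVariation s ψ

/-- `s` is regularly varying and `ω` is its index: the limit function is `ψ(λ) = λ ^ ω`. -/
def IsRegularlyVaryingOfIndex (s : ℕ → ℝ) (ω : ℝ) : Prop :=
  IsRegularlyVarying s ∧ ∀ ψ : ℝ → ℝ, HasVariation s ψ → ∀ x : ℝ, 0 < x → ψ x = x ^ ω

end ProximateOrders

end

/-! Write `a p = log m_p`. Since `log M_p` is the sum of the first `p` terms of `a`, `β_p` is the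
gap between `a p` and the mean of its predecessors.

The means telescope: `a p = β_p + ∑_{k<p} β_k / (k+1)`, a discrete Karamata representation. If `β →
w`, comparison with harmonic sums gives `a ⌊xp⌋ - a p → w log x`, hence (c) and (d), and also `a p /
log p → w`. Conversely `β_p = ∫₀¹ (a p - a ⌊xp⌋) dx`; under (d), monotonicity extends the limit to
real `x ≤ 1`, and dominated convergence yields `β_p → -w ∫₀¹ log x dx = w`
(`tendsto_meanDiff_of_tendsto_mul_sub`).

For (a), let `n` be the number of quotients below `t`. Away from the quotients, `t d'(t) log t = n /
M(t) - d(t)` (`mul_slope_mul_log`), so the derivative condition with `d → L` says `n / M(t) → L`.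
Since `M(m_p) = p β_p` (`assocFun_quot`), this amounts to `β → 1/L`. -/

namespace ProximateOrders

/-! ### Sequences whose gap to the running mean converges -/

/-- The difference between the `p`-th term of a sequence and the mean of the preceding ones. -/
noncomputable def meanDiff (a : ℕ → ℝ) (p : ℕ) : ℝ := a p - (∑ k ∈ Finset.range p, a k) / p

/-- Passing from `p` to `p + 1` terms changes the mean by exactly `meanDiff a p / (p + 1)`. For `p =
0` the convention `0 / 0 = 0` makes `meanDiff a 0 = a 0`, so the telescoping has no boundary term.
-/
theorem mean_eq_sum_meanDiff (a : ℕ → ℝ) (p : ℕ) :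
    (∑ k ∈ Finset.range p, a k) / p = ∑ k ∈ Finset.range p, meanDiff a k / (k + 1) := by
  induction p with
  | zero => simp
  | succ p ih =>
    rw [Finset.sum_range_succ _ p, Finset.sum_range_succ _ p, ← ih, meanDiff]
    rcases Nat.eq_zero_or_pos p with rfl | hp
    · simp
    · have : (p : ℝ) ≠ 0 := by positivity
      push_cast
      field_simp
      ring

theorem harmonic_cast_eq_sum (p : ℕ) :
    ((harmonic p : ℚ) : ℝ) = ∑ k ∈ Finset.range p, 1 / ((k : ℝ) + 1) := by
  simp [harmonic]

theorem tendsto_log_natCast_atTop : Tendsto (fun p : ℕ => Real.log p) atTop atTop :=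
  Real.tendsto_log_atTop.comp tendsto_natCast_atTop_atTop

theorem tendsto_harmonic_atTop : Tendsto (fun p : ℕ => ((harmonic p : ℚ) : ℝ)) atTop atTop := by
  have := tendsto_log_natCast_atTop.atTop_add Real.tendsto_harmonic_sub_log
  simpa using this

theorem tendsto_harmonic_div_log :
    Tendsto (fun p : ℕ => ((harmonic p : ℚ) : ℝ) / Real.log p) atTop (𝓝 1) := by
  have h := (Real.tendsto_harmonic_sub_log.div_atTop tendsto_log_natCast_atTop).add_const 1
  rw [zero_add] at h
  refine h.congr' ?_
  filter_upwards [tendsto_log_natCast_atTop.eventually_gt_atTop 0] with p hp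
  field_simp
  ring

/-- In the representation of `a p`, replacing `meanDiff a k` by `w` costs `o(H_p)`, where the
harmonic number `H_p` is asymptotic to `log p`. -/
theorem tendsto_div_log_of_tendsto_meanDiff {a : ℕ → ℝ} {w : ℝ}
    (h : Tendsto (meanDiff a) atTop (𝓝 w)) :
    Tendsto (fun p : ℕ => a p / Real.log p) atTop (𝓝 w) := by
  have h1 : (fun k : ℕ => (meanDiff a k - w) / ((k : ℝ) + 1)) =o[atTop]
      fun k : ℕ => 1 / ((k : ℝ) + 1) := by
    have : (fun k : ℕ => meanDiff a k - w) =o[atTop] fun _ => (1 : ℝ) := by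
      rw [Asymptotics.isLittleO_one_iff]
      simpa using h.sub_const w
    simpa [div_eq_mul_inv] using
      this.mul_isBigO (Asymptotics.isBigO_refl (fun k : ℕ => ((k : ℝ) + 1)⁻¹) atTop)
  have h2 := h1.sum_range (fun k => by positivity) (by
    simpa only [← harmonic_cast_eq_sum] using tendsto_harmonic_atTop)
  simp only [← harmonic_cast_eq_sum] at h2
  have h3 := h2.tendsto_div_nhds_zero
  have h4 := ((h.div_atTop tendsto_log_natCast_atTop).add
    (h3.mul tendsto_harmonic_div_log)).add (tendsto_harmonic_div_log.const_mul w)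
  simp only [mul_one, zero_add] at h4
  refine h4.congr' ?_
  filter_upwards [tendsto_log_natCast_atTop.eventually_gt_atTop 0,
    tendsto_harmonic_atTop.eventually_gt_atTop 0] with p hp hH
  have e1 : a p = meanDiff a p + ∑ k ∈ Finset.range p, meanDiff a k / (k + 1) := by
    rw [← mean_eq_sum_meanDiff, meanDiff]; ring
  have e2 : ∑ k ∈ Finset.range p, (meanDiff a k - w) / ((k : ℝ) + 1) =
      ∑ k ∈ Finset.range p, meanDiff a k / (k + 1) - w * (harmonic p : ℚ) := by
    rw [harmonic_cast_eq_sum, Finset.mul_sum, ← Finset.sum_sub_distrib]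
    exact Finset.sum_congr rfl fun k _ => by ring
  rw [e2, e1]
  field_simp
  ring

theorem tendsto_natFloor_mul_atTop {x : ℝ} (hx : 0 < x) :
    Tendsto (fun p : ℕ => ⌊x * p⌋₊) atTop atTop :=
  tendsto_nat_floor_atTop.comp (tendsto_natCast_atTop_atTop.const_mul_atTop hx)

theorem tendsto_log_natFloor_mul_sub_log {x : ℝ} (hx : 0 < x) :
    Tendsto (fun p : ℕ => Real.log (⌊x * p⌋₊ : ℕ) - Real.log p) atTop (𝓝 (Real.log x)) := by
  have h := ((tendsto_nat_floor_mul_div_atTop hx.le).comp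
    (tendsto_natCast_atTop_atTop (R := ℝ))).log hx.ne'
  refine h.congr' ?_
  filter_upwards [(tendsto_natFloor_mul_atTop hx).eventually_gt_atTop 0,
    eventually_gt_atTop 0] with p h1 h2
  simp only [Function.comp_apply]
  rw [Real.log_div (by positivity) (by positivity)]

theorem tendsto_harmonic_natFloor_mul_sub {x : ℝ} (hx : 0 < x) :
    Tendsto (fun p : ℕ => ((harmonic ⌊x * p⌋₊ : ℚ) : ℝ) - (harmonic p : ℚ)) atTop
      (𝓝 (Real.log x)) := by
  have h := ((Real.tendsto_harmonic_sub_log.comp (tendsto_natFloor_mul_atTop hx)).sub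
    Real.tendsto_harmonic_sub_log).add (tendsto_log_natFloor_mul_sub_log hx)
  rw [sub_self, zero_add] at h
  refine h.congr fun p => ?_
  simp only [Function.comp_apply]
  ring

theorem abs_sum_div_sub_le {b : ℕ → ℝ} {ε : ℝ} {K p q : ℕ} (hb : ∀ k, K ≤ k → |b k| ≤ ε)
    (hp : K ≤ p) (hpq : p ≤ q) :
    |∑ k ∈ Finset.range q, b k / ((k : ℝ) + 1) - ∑ k ∈ Finset.range p, b k / ((k : ℝ) + 1)| ≤
      ε * |((harmonic q : ℚ) : ℝ) - (harmonic p : ℚ)| := by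
  have hε : 0 ≤ ε := (abs_nonneg _).trans (hb K le_rfl)
  rw [← Finset.sum_Ico_eq_sub _ hpq, harmonic_cast_eq_sum, harmonic_cast_eq_sum,
    ← Finset.sum_Ico_eq_sub _ hpq]
  refine (Finset.abs_sum_le_sum_abs _ _).trans ?_
  refine le_trans ?_ (mul_le_mul_of_nonneg_left (le_abs_self _) hε)
  rw [Finset.mul_sum]
  refine Finset.sum_le_sum fun k hk => ?_
  have h1 : (0 : ℝ) < (k : ℝ) + 1 := by positivity
  rw [abs_div, abs_of_pos h1, mul_one_div]
  have := hb k (hp.trans (Finset.mem_Ico.1 hk).1)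
  gcongr

/-- Subtract the representations at `⌊xp⌋` and `p`. The main term is `w` times a harmonic difference
tending to `log x`; the error is that bounded difference weighted by coefficients tending to zero.
-/
theorem tendsto_natFloor_mul_sub_of_tendsto_meanDiff {a : ℕ → ℝ} {w : ℝ}
    (h : Tendsto (meanDiff a) atTop (𝓝 w)) {x : ℝ} (hx : 0 < x) :
    Tendsto (fun p : ℕ => a ⌊x * p⌋₊ - a p) atTop (𝓝 (w * Real.log x)) := by
  set s : ℕ → ℝ := fun p => ∑ k ∈ Finset.range p, (meanDiff a k - w) / ((k : ℝ) + 1) with hs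
  have hH := tendsto_harmonic_natFloor_mul_sub hx
  have hs0 : Tendsto (fun p : ℕ => s ⌊x * p⌋₊ - s p) atTop (𝓝 0) := by
    rw [Metric.tendsto_nhds]
    intro ε hε
    -- `C` eventually bounds the harmonic difference, whose limit is `log x`.
    set C := |Real.log x| + 1 with hC
    have hC0 : 0 < C := by positivity
    have hb : ∀ᶠ k in atTop, |meanDiff a k - w| ≤ ε / (2 * C) := by
      have := (Metric.tendsto_nhds.1 h) (ε / (2 * C)) (by positivity)
      filter_upwards [this] with k hk
      exact hk.le
    obtain ⟨K, hK⟩ := eventually_atTop.1 hb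
    filter_upwards [eventually_ge_atTop K,
      (tendsto_natFloor_mul_atTop hx).eventually_ge_atTop K,
      hH.abs.eventually_lt_const (show |Real.log x| < C by simp [hC])] with p h1 h2 h3
    rw [Real.dist_eq, sub_zero]
    have key : |s ⌊x * p⌋₊ - s p| ≤
        ε / (2 * C) * |((harmonic ⌊x * p⌋₊ : ℚ) : ℝ) - (harmonic p : ℚ)| := by
      rcases le_total p ⌊x * p⌋₊ with hle | hle
      · exact abs_sum_div_sub_le hK h1 hle
      · rw [abs_sub_comm, abs_sub_comm (Rat.cast _)]
        exact abs_sum_div_sub_le hK h2 hle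
    refine key.trans_lt ?_
    calc _ ≤ ε / (2 * C) * C := by gcongr
      _ = ε / 2 := by field_simp
      _ < ε := by linarith
  have h5 := (((h.comp (tendsto_natFloor_mul_atTop hx)).sub h).add hs0).add (hH.const_mul w)
  rw [sub_self, zero_add, zero_add] at h5
  refine h5.congr fun p => ?_
  have e1 : ∀ p, a p = meanDiff a p + s p + w * (harmonic p : ℚ) := by
    intro p
    have e2 : s p = ∑ k ∈ Finset.range p, meanDiff a k / (k + 1) - w * (harmonic p : ℚ) := by
      rw [hs, harmonic_cast_eq_sum, Finset.mul_sum, ← Finset.sum_sub_distrib]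
      exact Finset.sum_congr rfl fun k _ => by ring
    rw [e2, ← mean_eq_sum_meanDiff, meanDiff]
    ring
  simp only [Function.comp_apply]
  rw [e1 ⌊x * p⌋₊, e1 p]
  ring

/-! ### From integer dilations back to the mean -/

/-- With `n = p / N`, monotonicity traps `a p` and `a ⌊xp⌋` between values of `a` at fixed integer
multiples of `n`, where the hypothesis applies. The limit `p → ∞` is taken for fixed `N`; the
resulting bounds close up as `N → ∞`. -/
theorem tendsto_natFloor_mul_sub_of_tendsto_mul_sub {a : ℕ → ℝ} (ha : Monotone a) {w : ℝ}
    (h : ∀ ℓ : ℕ, 1 ≤ ℓ → Tendsto (fun p : ℕ => a (ℓ * p) - a p) atTop (𝓝 (w * Real.log ℓ)))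
    {x : ℝ} (hx : 0 < x) (hx1 : x ≤ 1) :
    Tendsto (fun p : ℕ => a ⌊x * p⌋₊ - a p) atTop (𝓝 (w * Real.log x)) := by
  have hfl := tendsto_nat_floor_mul_div_atTop hx.le
  have hfl := hfl.comp (tendsto_natCast_atTop_atTop (R := ℝ))
  have hinv : ∀ c : ℝ, Tendsto (fun N : ℕ => c / (N : ℝ)) atTop (𝓝 0) := fun c =>
    tendsto_const_nhds.div_atTop tendsto_natCast_atTop_atTop
  have hlow : Tendsto (fun N : ℕ => w * (Real.log (⌊x * N⌋₊ : ℕ) - Real.log (N + 1 : ℕ))) atTop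
      (𝓝 (w * Real.log x)) := by
    have h1 := (hfl.div ((hinv 1).const_add 1) (by norm_num)).log
      (show x / (1 + 0) ≠ 0 by simpa using hx.ne')
    simp only [add_zero, div_one] at h1
    refine (h1.const_mul w).congr' ?_
    filter_upwards [eventually_gt_atTop 0,
      (tendsto_natFloor_mul_atTop hx).eventually_gt_atTop 0] with N hN hK
    rw [← Real.log_div (by positivity) (by positivity)]
    congr 2
    simp only [Pi.div_apply, Function.comp_apply]
    push_cast
    field_simp
  have hupp : Tendsto (fun N : ℕ => w * (Real.log (⌊x * N⌋₊ + 2 : ℕ) - Real.log (N : ℕ))) atTop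
      (𝓝 (w * Real.log x)) := by
    have h1 := (hfl.add (hinv 2)).log (show x + 0 ≠ 0 by simpa using hx.ne')
    simp only [add_zero] at h1
    refine (h1.const_mul w).congr' ?_
    filter_upwards [eventually_gt_atTop 0] with N hN
    rw [← Real.log_div (by positivity) (by positivity)]
    simp only [Function.comp_apply]
    congr 2
    push_cast
    field_simp
  have hdiff : ∀ i j : ℕ, 1 ≤ i → 1 ≤ j → Tendsto (fun n : ℕ => a (i * n) - a (j * n)) atTop
      (𝓝 (w * (Real.log i - Real.log j))) := by
    intro i j hi hj
    have := (h i hi).sub (h j hj)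
    rw [← mul_sub] at this
    refine this.congr fun n => by ring
  have hbounds : ∀ N : ℕ, 0 < N → ∀ᶠ p : ℕ in atTop,
      a (⌊x * N⌋₊ * (p / N)) - a ((N + 1) * (p / N)) ≤ a ⌊x * p⌋₊ - a p ∧
      a ⌊x * p⌋₊ - a p ≤ a ((⌊x * N⌋₊ + 2) * (p / N)) - a (N * (p / N)) := by
    intro N hN
    -- This ensures `N ≤ n`, so the remainder of `p` modulo `N` is absorbed: `p < N * n + N ≤ (N +
    -- 1) * n`.
    filter_upwards [eventually_ge_atTop (N * N)] with p hp
    set n := p / N with hn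
    have hnN : N ≤ n := (Nat.le_div_iff_mul_le hN).2 hp
    have h1 : N * n ≤ p := Nat.mul_div_le p N
    have h2 : p ≤ (N + 1) * n := by
      have := Nat.lt_mul_div_succ p hN
      rw [← hn] at this
      nlinarith
    have h1' : (N : ℝ) * n ≤ p := by exact_mod_cast h1
    have h2' : (p : ℝ) ≤ (N + 1) * n := by exact_mod_cast h2
    have h3 : ⌊x * N⌋₊ * n ≤ ⌊x * p⌋₊ := by
      refine Nat.le_floor ?_
      push_cast
      have := Nat.floor_le (show 0 ≤ x * N by positivity)
      calc (⌊x * N⌋₊ : ℝ) * n ≤ x * N * n := by gcongr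
        _ = x * (N * n) := by ring
        _ ≤ x * p := by gcongr
    -- Of the `+ 2`, one unit pays for the floor of `x * N`, the other for the extra `x ≤ 1` coming
    -- from `N + 1`.
    have h4 : ⌊x * p⌋₊ ≤ (⌊x * N⌋₊ + 2) * n := by
      refine Nat.floor_le_of_le ?_
      push_cast
      have := (Nat.lt_floor_add_one (x * N)).le
      calc x * p ≤ x * ((N + 1) * n) := by gcongr
        _ = (x * N + x) * n := by ring
        _ ≤ ((⌊x * N⌋₊ + 1) + 1) * n := by gcongr
        _ = _ := by ring
    exact ⟨sub_le_sub (ha h3) (ha h2), sub_le_sub (ha h4) (ha h1)⟩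
  have hdivN : ∀ N : ℕ, 0 < N → Tendsto (fun p : ℕ => p / N) atTop atTop := fun N hN =>
    Nat.tendsto_div_const_atTop hN.ne'
  rw [tendsto_order]
  constructor
  · intro y hy
    obtain ⟨N, hN1, hN2, hN3⟩ := ((hlow.eventually_const_lt hy).and ((eventually_gt_atTop 0).and
      ((tendsto_natFloor_mul_atTop hx).eventually_gt_atTop 0))).exists
    filter_upwards [hbounds N hN2, (((hdiff ⌊x * N⌋₊ (N + 1) hN3 (by omega)).comp
      (hdivN N hN2)).eventually_const_lt hN1)] with p h1 h2
    exact lt_of_lt_of_le h2 h1.1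
  · intro y hy
    obtain ⟨N, hN1, hN2⟩ := ((hupp.eventually_lt_const hy).and (eventually_gt_atTop 0)).exists
    filter_upwards [hbounds N hN2, (((hdiff (⌊x * N⌋₊ + 2) N (by omega) hN2).comp
      (hdivN N hN2)).eventually_lt_const hN1)] with p h1 h2
    exact lt_of_le_of_lt h1.2 h2

theorem integral_natFloor (f : ℕ → ℝ) (p : ℕ) :
    ∫ y in (0 : ℝ)..p, f ⌊y⌋₊ = ∑ k ∈ Finset.range p, f k := by
  have hEq : ∀ k : ℕ, (Set.Ioo (k : ℝ) ((k + 1 : ℕ) : ℝ)).EqOn (fun y => f ⌊y⌋₊)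
      fun _ => f k := by
    intro k y hy
    have : ⌊y⌋₊ = k :=
      (Nat.floor_eq_iff ((Nat.cast_nonneg k).trans hy.1.le)).2
        ⟨hy.1.le, by simpa using hy.2⟩
    simp only [this]
  have h := intervalIntegral.sum_integral_adjacent_intervals (μ := MeasureTheory.volume)
    (f := fun y : ℝ => f ⌊y⌋₊) (a := fun k : ℕ => (k : ℝ)) (n := p) (fun k _ => by
      refine (intervalIntegrable_const (c := f k)).congr_uIoo ?_
      rw [Set.uIoo_of_le (by simp)]
      exact (hEq k).symm)
  rw [Nat.cast_zero] at h
  rw [← h]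
  refine Finset.sum_congr rfl fun k _ => ?_
  rw [intervalIntegral.integral_congr_Ioo_of_le (by simp) (hEq k)]
  simp

/-- The mean is the integral over `[0, 1]` of the step function `x ↦ a ⌊xp⌋`. -/
theorem meanDiff_eq_integral (a : ℕ → ℝ) {p : ℕ} (hp : 0 < p) :
    meanDiff a p = ∫ x in (0 : ℝ)..1, (a p - a ⌊x * p⌋₊) := by
  have hp' : (p : ℝ) ≠ 0 := by positivity
  rw [intervalIntegral.integral_comp_mul_right (fun y : ℝ => a p - a ⌊y⌋₊) hp', zero_mul, one_mul,
    integral_natFloor (fun k => a p - a k), Finset.sum_sub_distrib]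
  simp only [Finset.sum_const, Finset.card_range, nsmul_eq_mul, smul_eq_mul, meanDiff]
  field_simp

/-- About `log₂ (p / k)` doublings lead from `k` past `p`, each costing at most `C`. -/
theorem sub_le_of_doubling {a : ℕ → ℝ} (ha : Monotone a) {C : ℝ}
    (hC : ∀ p, a (2 * p) - a p ≤ C) {k p : ℕ} (hk : 0 < k) (hkp : k ≤ p) :
    a p - a k ≤ C * (1 + Real.log (p / k) / Real.log 2) := by
  have hC0 : 0 ≤ C := by simpa using hC 0
  have hpow : ∀ j : ℕ, a (2 ^ j * k) - a k ≤ j * C := by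
    intro j
    induction j with
    | zero => simp
    | succ j ih =>
      have := hC (2 ^ j * k)
      rw [← mul_assoc, ← pow_succ'] at this
      push_cast
      linarith
  have hk' : (0 : ℝ) < k := by positivity
  have hp' : (0 : ℝ) < p := by exact_mod_cast hk.trans_le hkp
  have h1 : (1 : ℝ) ≤ p / k := by
    rw [one_le_div hk']
    exact_mod_cast hkp
  have hl : 0 ≤ Real.log (p / k) / Real.log 2 :=
    div_nonneg (Real.log_nonneg h1) (Real.log_nonneg (by norm_num))
  set j := ⌈Real.log (p / k) / Real.log 2⌉₊ with hj
  have h2 : p ≤ 2 ^ j * k := by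
    have h3 : Real.log (p / k) ≤ Real.log (2 ^ j) := by
      rw [Real.log_pow, ← div_le_iff₀ (Real.log_pos (by norm_num))]
      exact Nat.le_ceil _
    have h4 := (Real.log_le_log_iff (by positivity) (by positivity)).1 h3
    rw [div_le_iff₀ hk'] at h4
    exact_mod_cast h4
  have h5 := ha h2
  have h6 := hpow j
  have h7 : (j : ℝ) ≤ 1 + Real.log (p / k) / Real.log 2 := by
    rw [add_comm]; exact (Nat.ceil_lt_add_one hl).le
  nlinarith

/-- The bound does not depend on `p` and has only a logarithmic singularity at `0`, so it serves as
integrable majorant. If `⌊xp⌋ ≥ 1` then `p / ⌊xp⌋ ≤ 2 / x`; the term `a 1 - a 0` covers `⌊xp⌋ = 0`.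
-/
theorem sub_natFloor_mul_le_of_doubling {a : ℕ → ℝ} (ha : Monotone a) {C : ℝ}
    (hC : ∀ p, a (2 * p) - a p ≤ C) {p : ℕ} (hp : 0 < p) {x : ℝ} (hx : 0 < x) (hx1 : x ≤ 1) :
    a p - a ⌊x * p⌋₊ ≤ (a 1 - a 0) + C * (1 + (Real.log 2 - Real.log x) / Real.log 2) := by
  have hC0 : 0 ≤ C := by simpa using hC 0
  have h01 : a 0 ≤ a 1 := ha (Nat.zero_le 1)
  have hp' : (0 : ℝ) < p := by positivity
  have hl2 : 0 < Real.log 2 := Real.log_pos (by norm_num)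
  rw [← Real.log_div two_ne_zero hx.ne']
  rcases Nat.eq_zero_or_pos ⌊x * p⌋₊ with h0 | hk
  · have h1 := sub_le_of_doubling ha hC one_pos hp
    rw [Nat.floor_eq_zero] at h0
    have h2 : (p : ℝ) / (1 : ℕ) ≤ 2 / x := by
      rw [Nat.cast_one, div_one, le_div_iff₀ hx]
      linarith
    have h3 : Real.log (p / (1 : ℕ)) ≤ Real.log (2 / x) := Real.log_le_log (by simpa using hp') h2
    rw [Nat.floor_eq_zero.2 h0]
    have : C * (1 + Real.log (p / (1 : ℕ)) / Real.log 2) ≤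
      C * (1 + Real.log (2 / x) / Real.log 2) := by gcongr
    linarith
  · have hkp : ⌊x * p⌋₊ ≤ p := Nat.floor_le_of_le (by nlinarith)
    have h1 := sub_le_of_doubling ha hC hk hkp
    have hk' : (1 : ℝ) ≤ (⌊x * p⌋₊ : ℕ) := by exact_mod_cast hk
    have h2 : (p : ℝ) / (⌊x * p⌋₊ : ℕ) ≤ 2 / x := by
      rw [div_le_div_iff₀ (by linarith) hx]
      have := Nat.lt_floor_add_one (x * p)
      linarith
    have h3 : Real.log (p / (⌊x * p⌋₊ : ℕ)) ≤ Real.log (2 / x) :=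
      Real.log_le_log (by positivity) h2
    have : C * (1 + Real.log (p / (⌊x * p⌋₊ : ℕ)) / Real.log 2) ≤
      C * (1 + Real.log (2 / x) / Real.log 2) := by gcongr
    linarith

theorem tendsto_meanDiff_of_tendsto_mul_sub {a : ℕ → ℝ} (ha : Monotone a) {w : ℝ}
    (h : ∀ ℓ : ℕ, 1 ≤ ℓ → Tendsto (fun p : ℕ => a (ℓ * p) - a p) atTop (𝓝 (w * Real.log ℓ))) :
    Tendsto (meanDiff a) atTop (𝓝 w) := by
  obtain ⟨C, hC⟩ := (h 2 one_le_two).bddAbove_range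
  replace hC : ∀ p, a (2 * p) - a p ≤ C := fun p => hC ⟨p, rfl⟩
  have key := intervalIntegral.tendsto_integral_filter_of_dominated_convergence
    (μ := MeasureTheory.volume) (a := (0 : ℝ)) (b := 1) (l := (atTop : Filter ℕ))
    (F := fun p x => a p - a ⌊x * p⌋₊) (f := fun x => -(w * Real.log x))
    (fun x => (a 1 - a 0) + C * (1 + (Real.log 2 - Real.log x) / Real.log 2))
    (Eventually.of_forall fun p => by
      refine Measurable.aestronglyMeasurable ?_
      exact measurable_const.sub (measurable_from_nat.comp
        (Nat.measurable_floor.comp (measurable_id.mul_const _))))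
    (by
      filter_upwards [eventually_gt_atTop 0] with p hp
      refine Eventually.of_forall fun x hx => ?_
      rw [Set.uIoc_of_le zero_le_one] at hx
      have hle : ⌊x * p⌋₊ ≤ p :=
        Nat.floor_le_of_le (by nlinarith [hx.2, (Nat.cast_nonneg p : (0 : ℝ) ≤ p)])
      rw [Real.norm_of_nonneg (sub_nonneg.2 (ha hle))]
      exact sub_natFloor_mul_le_of_doubling ha hC hp hx.1 hx.2)
    (by
      have := intervalIntegral.intervalIntegrable_log' (a := 0) (b := 1)
      exact intervalIntegrable_const.add ((intervalIntegrable_const.add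
        ((intervalIntegrable_const.sub this).div_const _)).const_mul _))
    (Eventually.of_forall fun x hx => by
      rw [Set.uIoc_of_le zero_le_one] at hx
      have := (tendsto_natFloor_mul_sub_of_tendsto_mul_sub ha h hx.1 hx.2).neg
      simpa using this)
  have hint : ∫ x in (0 : ℝ)..1, -(w * Real.log x) = w := by
    rw [intervalIntegral.integral_neg, intervalIntegral.integral_const_mul, integral_log]
    simp
  rw [hint] at key
  refine key.congr' ?_
  filter_upwards [eventually_gt_atTop 0] with p hp
  exact (meanDiff_eq_integral a hp).symm


/-! ### The associated function of a log-convex sequence -/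

/-- The standing assumptions on the sequence `M`. -/
structure IsAdmissible (M : ℕ → ℝ) : Prop where
  pos : ∀ p, 0 < M p
  zero : M 0 = 1
  logConvex : IsLogConvex M
  tendsto_quot : Tendsto (quot M) atTop atTop

/-- The logarithms of the quotients. -/
noncomputable def logQuot (M : ℕ → ℝ) (p : ℕ) : ℝ := Real.log (quot M p)

namespace IsAdmissible

variable {M : ℕ → ℝ}

theorem quot_pos (h : IsAdmissible M) (p : ℕ) : 0 < quot M p := div_pos (h.pos _) (h.pos _)

theorem monotone_quot (h : IsAdmissible M) : Monotone (quot M) := by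
  refine monotone_nat_of_le_succ fun p => ?_
  have := h.logConvex (p + 1) (by omega)
  rw [quot, quot, div_le_div_iff₀ (h.pos _) (h.pos _)]
  simp only [Nat.add_sub_cancel] at this
  linarith

theorem monotone_logQuot (h : IsAdmissible M) : Monotone (logQuot M) := fun _ _ hpq =>
  Real.log_le_log (h.quot_pos _) (h.monotone_quot hpq)

theorem log_eq_sum (h : IsAdmissible M) (n : ℕ) :
    Real.log (M n) = ∑ k ∈ Finset.range n, logQuot M k := by
  induction n with
  | zero => simp [h.zero]
  | succ n ih =>
    rw [Finset.sum_range_succ, ← ih, logQuot, quot,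
      Real.log_div (h.pos _).ne' (h.pos _).ne']
    ring

theorem beta_eq_meanDiff (h : IsAdmissible M) : beta M = meanDiff (logQuot M) := by
  funext p
  rw [beta, meanDiff, Real.log_div (h.quot_pos p).ne' (Real.rpow_pos_of_pos (h.pos p) _).ne',
    Real.log_rpow (h.pos p), ← h.log_eq_sum, logQuot]
  ring

theorem log_pow_div (h : IsAdmissible M) {t : ℝ} (ht : 0 < t) (p : ℕ) :
    Real.log (t ^ p / M p) = p * Real.log t - Real.log (M p) := by
  rw [Real.log_div (pow_pos ht p).ne' (h.pos p).ne', Real.log_pow]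

/-- The increments `log t - log m_p` of the competing terms decrease in `p`, so the supremum is
reached where they change sign. Both inequalities are weak, so when `t` is a quotient several `n`
are admissible; this yields the formulas on either side of `t`. -/
theorem assocFun_eq (h : IsAdmissible M) {t : ℝ} (ht : 0 < t) {n : ℕ}
    (h1 : ∀ k < n, quot M k ≤ t) (h2 : t ≤ quot M n) :
    assocFun M t = n * Real.log t - Real.log (M n) := by
  rw [← h.log_pow_div ht]
  have hstep : ∀ p : ℕ, Real.log (t ^ (p + 1) / M (p + 1)) =
      Real.log (t ^ p / M p) + (Real.log t - logQuot M p) := by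
    intro p
    rw [h.log_pow_div ht, h.log_pow_div ht, h.log_eq_sum, h.log_eq_sum, Finset.sum_range_succ]
    push_cast
    ring
  have hup : ∀ p, n ≤ p → Real.log (t ^ p / M p) ≤ Real.log (t ^ n / M n) := by
    intro p hp
    induction p, hp using Nat.le_induction with
    | base => exact le_rfl
    | succ p hp ih =>
      have : Real.log t ≤ logQuot M p := Real.log_le_log ht (h2.trans (h.monotone_quot hp))
      rw [hstep]
      linarith
  have hdown : ∀ j p, p + j = n → Real.log (t ^ p / M p) ≤ Real.log (t ^ n / M n) := by
    intro j
    induction j with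
    | zero => rintro p rfl; exact le_rfl
    | succ j ih =>
      intro p hp
      have : logQuot M p ≤ Real.log t := Real.log_le_log (h.quot_pos p) (h1 p (by omega))
      have := ih (p + 1) (by omega)
      rw [hstep] at this
      linarith
  refine le_antisymm (ciSup_le fun p => ?_)
    (le_ciSup (bddAbove_assocFun M h.pos h.tendsto_quot t ht) n)
  rcases le_total n p with hp | hp
  · exact hup p hp
  · exact hdown (n - p) p (by omega)

theorem monotoneOn_assocFun (h : IsAdmissible M) : MonotoneOn (assocFun M) (Set.Ioi 0) := by
  intro s hs t ht hst
  refine ciSup_mono (bddAbove_assocFun M h.pos h.tendsto_quot t ht) fun p => ?_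
  rw [h.log_pow_div hs, h.log_pow_div ht]
  have := Real.log_le_log hs hst
  gcongr

theorem assocFun_quot (h : IsAdmissible M) (p : ℕ) :
    assocFun M (quot M p) = p * beta M p := by
  rw [h.assocFun_eq (h.quot_pos p) (fun k hk => h.monotone_quot hk.le) le_rfl,
    h.beta_eq_meanDiff, meanDiff, h.log_eq_sum, logQuot]
  rcases Nat.eq_zero_or_pos p with rfl | hp
  · simp
  · have : (p : ℝ) ≠ 0 := by positivity
    field_simp

theorem tendsto_assocFun (h : IsAdmissible M) : Tendsto (assocFun M) atTop atTop := by
  refine tendsto_atTop_mono' atTop ?_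
    (tendsto_atTop_add_const_right _ (-Real.log (M 1)) Real.tendsto_log_atTop)
  filter_upwards [eventually_gt_atTop 0] with t ht
  have := le_ciSup (bddAbove_assocFun M h.pos h.tendsto_quot t ht) 1
  simp only [h.log_pow_div ht] at this
  rw [assocFun]
  simp only [h.log_pow_div ht]
  push_cast at this
  linarith

end IsAdmissible

/-! ### Counting quotients, and the piecewise regularity of `dFun` -/

/-- The number of quotients that are smaller than `t`. -/
noncomputable def count (M : ℕ → ℝ) (t : ℝ) : ℕ := sInf {n | t ≤ quot M n}

namespace IsAdmissible

variable {M : ℕ → ℝ}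

theorem le_quot_count (h : IsAdmissible M) (t : ℝ) : t ≤ quot M (count M t) :=
  Nat.sInf_mem (s := {n | t ≤ quot M n}) (h.tendsto_quot.eventually_ge_atTop t).exists

theorem quot_lt_of_lt_count {t : ℝ} {k : ℕ} (hk : k < count M t) :
    quot M k < t := not_le.1 (Nat.notMem_of_lt_sInf hk)

theorem exists_quot_le_lt_quot (h : IsAdmissible M) (t : ℝ) :
    ∃ n, (∀ k < n, quot M k ≤ t) ∧ t < quot M n := by
  classical
  have hex := (h.tendsto_quot.eventually_gt_atTop t).exists
  exact ⟨Nat.find hex, fun k hk => not_lt.1 (Nat.find_min hex hk), Nat.find_spec hex⟩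

theorem tendsto_count (h : IsAdmissible M) : Tendsto (count M) atTop atTop := by
  refine tendsto_atTop.2 fun n => ?_
  filter_upwards [eventually_gt_atTop (quot M n)] with t ht
  by_contra hlt
  exact absurd ((h.le_quot_count t).trans (h.monotone_quot (not_le.1 hlt).le)) (not_le.2 ht)

theorem assocFun_eq_count (h : IsAdmissible M) {t : ℝ} (ht : 0 < t) :
    assocFun M t = count M t * Real.log t - Real.log (M (count M t)) :=
  h.assocFun_eq ht (fun _ hk => (quot_lt_of_lt_count hk).le) (h.le_quot_count t)

theorem eventually_forall_quot_lt {t : ℝ} {n : ℕ} (h1 : ∀ k < n, quot M k < t) :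
    ∀ᶠ s in 𝓝 t, ∀ k < n, quot M k < s := by
  have : ∀ᶠ s in 𝓝 t, ∀ k ∈ Finset.range n, quot M k < s :=
    (eventually_all_finset _).2 fun k hk => eventually_gt_nhds (h1 k (Finset.mem_range.1 hk))
  simpa using this

theorem assocFun_eventuallyEq_left (h : IsAdmissible M) {t : ℝ} (ht : 0 < t) {n : ℕ}
    (h1 : ∀ k < n, quot M k < t) (h2 : t ≤ quot M n) :
    assocFun M =ᶠ[𝓝[≤] t] fun s => n * Real.log s - Real.log (M n) := by
  filter_upwards [nhdsWithin_le_nhds (eventually_forall_quot_lt h1),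
    nhdsWithin_le_nhds (eventually_gt_nhds ht), self_mem_nhdsWithin] with s hs hs0 hst
  exact h.assocFun_eq hs0 (fun k hk => (hs k hk).le) (le_trans hst h2)

theorem assocFun_eventuallyEq_right (h : IsAdmissible M) {t : ℝ} (ht : 0 < t) {n : ℕ}
    (h1 : ∀ k < n, quot M k ≤ t) (h2 : t < quot M n) :
    assocFun M =ᶠ[𝓝[≥] t] fun s => n * Real.log s - Real.log (M n) := by
  filter_upwards [nhdsWithin_le_nhds (eventually_lt_nhds h2), self_mem_nhdsWithin] with s hs hst
  exact h.assocFun_eq (ht.trans_le hst) (fun k hk => (h1 k hk).trans hst) hs.le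

theorem assocFun_eventuallyEq (h : IsAdmissible M) {t : ℝ} (ht : 0 < t) {n : ℕ}
    (h1 : ∀ k < n, quot M k < t) (h2 : t < quot M n) :
    assocFun M =ᶠ[𝓝 t] fun s => n * Real.log s - Real.log (M n) := by
  rw [← nhdsLE_sup_nhdsGE]
  exact eventually_sup.2 ⟨h.assocFun_eventuallyEq_left ht h1 h2.le,
    h.assocFun_eventuallyEq_right ht (fun k hk => (h1 k hk).le) h2⟩

theorem continuousAt_assocFun (h : IsAdmissible M) {t : ℝ} (ht : 0 < t) :
    ContinuousAt (assocFun M) t := by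
  have hc : ∀ n : ℕ, ContinuousAt (fun s => n * Real.log s - Real.log (M n)) t := fun n =>
    ((Real.continuousAt_log ht.ne').const_mul _).sub_const _
  rw [continuousAt_iff_continuous_left_right]
  constructor
  · exact (hc _).continuousWithinAt.congr_of_eventuallyEq_of_mem
      (h.assocFun_eventuallyEq_left ht (fun _ => quot_lt_of_lt_count) (h.le_quot_count t))
      Set.self_mem_Iic
  · obtain ⟨n, h1, h2⟩ := h.exists_quot_le_lt_quot t
    exact (hc _).continuousWithinAt.congr_of_eventuallyEq_of_mem
      (h.assocFun_eventuallyEq_right ht h1 h2) Set.self_mem_Ici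

theorem continuousAt_dFun (h : IsAdmissible M) {t : ℝ} (ht : 1 < t) (hM : 0 < assocFun M t) :
    ContinuousAt (dFun M) t :=
  ((h.continuousAt_assocFun (by linarith)).log hM.ne').div
    (Real.continuousAt_log (by linarith)) (Real.log_pos ht).ne'

/-- The derivative of `log M(t) / log t` when `M` has derivative `n / t`. -/
noncomputable def slope (M : ℕ → ℝ) (n : ℕ) (t : ℝ) : ℝ :=
  (n / assocFun M t - dFun M t) / (t * Real.log t)

theorem hasDerivWithinAt_dFun {t : ℝ} {n : ℕ} {s : Set ℝ} (ht : 1 < t)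
    (hM : 0 < assocFun M t) (hmem : t ∈ s)
    (heq : assocFun M =ᶠ[𝓝[s] t] fun s => n * Real.log s - Real.log (M n)) :
    HasDerivWithinAt (dFun M) (slope M n t) s t := by
  have ht0 : t ≠ 0 := by linarith
  have hl : Real.log t ≠ 0 := (Real.log_pos ht).ne'
  have heqt := heq.self_of_nhdsWithin hmem
  have hA : HasDerivWithinAt (assocFun M) (n * t⁻¹) s t :=
    ((((Real.hasDerivAt_log ht0).const_mul (n : ℝ)).sub_const
      (Real.log (M n))).hasDerivWithinAt).congr_of_eventuallyEq heq heqt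
  have hd := (hA.log hM.ne').div (Real.hasDerivAt_log ht0).hasDerivWithinAt hl
  refine hd.congr_deriv ?_
  rw [slope, dFun]
  field_simp

theorem hasDerivWithinAt_dFun_left (h : IsAdmissible M) {t : ℝ} {n : ℕ} (ht : 1 < t)
    (hM : 0 < assocFun M t) (h1 : ∀ k < n, quot M k < t) (h2 : t ≤ quot M n) :
    HasDerivWithinAt (dFun M) (slope M n t) (Set.Iic t) t :=
  hasDerivWithinAt_dFun ht hM Set.self_mem_Iic
    (h.assocFun_eventuallyEq_left (by linarith) h1 h2)

theorem hasDerivWithinAt_dFun_right (h : IsAdmissible M) {t : ℝ} {n : ℕ} (ht : 1 < t)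
    (hM : 0 < assocFun M t) (h1 : ∀ k < n, quot M k ≤ t) (h2 : t < quot M n) :
    HasDerivWithinAt (dFun M) (slope M n t) (Set.Ici t) t :=
  hasDerivWithinAt_dFun ht hM Set.self_mem_Ici
    (h.assocFun_eventuallyEq_right (by linarith) h1 h2)

theorem hasDerivAt_dFun (h : IsAdmissible M) {t : ℝ} {n : ℕ} (ht : 1 < t)
    (hM : 0 < assocFun M t) (h1 : ∀ k < n, quot M k < t) (h2 : t < quot M n) :
    HasDerivAt (dFun M) (slope M n t) t := by
  rw [← hasDerivWithinAt_univ]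
  refine hasDerivWithinAt_dFun ht hM (Set.mem_univ t) ?_
  rw [nhdsWithin_univ]
  exact h.assocFun_eventuallyEq (by linarith) h1 h2

/-- The left-hand formula with `count M t` is valid at every `t`, so uniqueness of the left
derivative avoids asking whether `t` is a quotient. -/
theorem deriv_dFun_of_differentiableAt (h : IsAdmissible M) {t : ℝ} (ht : 1 < t)
    (hM : 0 < assocFun M t) (hd : DifferentiableAt ℝ (dFun M) t) :
    deriv (dFun M) t = slope M (count M t) t :=
  (uniqueDiffWithinAt_Iic t).eq_deriv _ hd.hasDerivAt.hasDerivWithinAt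
    (h.hasDerivWithinAt_dFun_left ht hM (fun _ => quot_lt_of_lt_count) (h.le_quot_count t))

theorem mul_slope_mul_log {t : ℝ} (n : ℕ) (ht : 1 < t) :
    t * slope M n t * Real.log t = n / assocFun M t - dFun M t := by
  have hl : Real.log t ≠ 0 := (Real.log_pos ht).ne'
  have ht0 : t ≠ 0 := by linarith
  rw [slope]
  field_simp

theorem lt_quot_count_of_notMem (h : IsAdmissible M) {t : ℝ} (ht : t ∉ Set.range (quot M)) :
    t < quot M (count M t) :=
  lt_of_le_of_ne (h.le_quot_count t) fun he => ht ⟨_, he.symm⟩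

theorem finite_range_quot_inter_Iic (h : IsAdmissible M) (R : ℝ) :
    (Set.range (quot M) ∩ Set.Iic R).Finite := by
  obtain ⟨N, hN⟩ := eventually_atTop.1 (h.tendsto_quot.eventually_gt_atTop R)
  refine ((Set.finite_Iio N).image (quot M)).subset ?_
  rintro _ ⟨⟨k, rfl⟩, hk⟩
  exact ⟨k, not_le.1 fun hle => (hN k hle).not_ge hk, rfl⟩

theorem isPiecewiseC1_dFun (h : IsAdmissible M) {c : ℝ} (hc : 1 ≤ c)
    (hM : ∀ t, c < t → 0 < assocFun M t) : IsPiecewiseC1 (dFun M) c := by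
  have hdiff : ∀ r ∈ Set.Ioi c \ (Set.range (quot M) ∩ Set.Ioi c),
      HasDerivAt (dFun M) (slope M (count M r) r) r ∧ ContinuousAt (deriv (dFun M)) r := by
    rintro r ⟨hr, hrS⟩
    have hr1 : 1 < r := lt_of_le_of_lt hc hr
    have hr0 : r ∉ Set.range (quot M) := fun hmem => hrS ⟨hmem, hr⟩
    have h1 : ∀ k < count M r, quot M k < r := fun _ => quot_lt_of_lt_count
    have h2 := h.lt_quot_count_of_notMem hr0
    refine ⟨h.hasDerivAt_dFun hr1 (hM r hr) h1 h2, ?_⟩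
    have hev : deriv (dFun M) =ᶠ[𝓝 r] slope M (count M r) := by
      filter_upwards [eventually_forall_quot_lt h1, eventually_lt_nhds h2,
        eventually_gt_nhds (Set.mem_Ioi.1 hr)] with s hs1 hs2 hs
      exact (h.hasDerivAt_dFun (hc.trans_lt hs) (hM s hs) hs1 hs2).deriv
    refine ContinuousAt.congr ?_ hev.symm
    have hr' : r ≠ 0 := by linarith
    exact ((continuousAt_const.div (h.continuousAt_assocFun (by linarith)) (hM r hr).ne').sub
      (h.continuousAt_dFun hr1 (hM r hr))).div
      (continuousAt_id.mul (Real.continuousAt_log hr'))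
      (mul_ne_zero hr' (Real.log_pos hr1).ne')
  refine ⟨fun t ht => (h.continuousAt_dFun (hc.trans_lt ht) (hM t ht)).continuousWithinAt,
    Set.range (quot M) ∩ Set.Ioi c, Set.inter_subset_right, fun R => ?_,
    fun r hr => (hdiff r hr).1.differentiableAt,
    fun r hr => (hdiff r hr).2.continuousWithinAt, ?_⟩
  · exact (h.finite_range_quot_inter_Iic R).subset fun x hx => ⟨hx.1.1, hx.2⟩
  · rintro r ⟨⟨p, rfl⟩, hr⟩
    have hr1 : 1 < quot M p := lt_of_le_of_lt hc hr
    have hMr := hM _ hr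
    obtain ⟨n, h1, h2⟩ := h.exists_quot_le_lt_quot (quot M p)
    have hL := h.hasDerivWithinAt_dFun_left hr1 hMr (fun _ => quot_lt_of_lt_count)
      (h.le_quot_count _)
    have hR := h.hasDerivWithinAt_dFun_right hr1 hMr h1 h2
    refine ⟨_, _, ?_, hL.mono Set.Iio_subset_Iic_self, hR.mono Set.Ioi_subset_Ici_self⟩
    -- The left and right indices straddle `p`, so `count < n`. At fixed `t`, `slope` is strictly
    -- increasing in its index, hence the lateral derivatives differ.
    have hcp : count M (quot M p) ≤ p := Nat.sInf_le (le_refl (quot M p))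
    have hpn : p < n := not_le.1 fun hle => h2.not_ge (h.monotone_quot hle)
    refine fun he => (hcp.trans_lt hpn).ne ?_
    have he' := congrArg (fun z => quot M p * z * Real.log (quot M p)) he
    simp only [mul_slope_mul_log _ hr1, sub_left_inj] at he'
    rw [div_left_inj' hMr.ne'] at he'
    exact_mod_cast he'


/-! ### Asymptotics of `assocFun` and the proximate order condition -/

theorem tendsto_logQuot_div_log (h : IsAdmissible M) {w : ℝ} (hb : Tendsto (beta M) atTop (𝓝 w)) :
    Tendsto (fun p : ℕ => Real.log (quot M p) / Real.log p) atTop (𝓝 w) := by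
  rw [h.beta_eq_meanDiff] at hb
  exact tendsto_div_log_of_tendsto_meanDiff hb

theorem omegaIndex_eq (h : IsAdmissible M) {w : ℝ} (hb : Tendsto (beta M) atTop (𝓝 w)) :
    omegaIndex M = (w : EReal) :=
  ((continuous_coe_real_ereal.tendsto w).comp (h.tendsto_logQuot_div_log hb)).liminf_eq

/-- With `n = count M t`, one has `m_{n-1} < t ≤ m_n`; monotonicity gives `(n-1) β_{n-1} ≤ M(t) ≤ n
β_n`. -/
theorem tendsto_assocFun_div_count (h : IsAdmissible M) {w : ℝ}
    (hb : Tendsto (beta M) atTop (𝓝 w)) :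
    Tendsto (fun t => assocFun M t / count M t) atTop (𝓝 w) := by
  have hcount := h.tendsto_count
  have hlow : Tendsto (fun n : ℕ => ((n - 1 : ℕ) : ℝ) * beta M (n - 1) / n) atTop (𝓝 w) := by
    have h1 : Tendsto (fun n : ℕ => 1 - 1 / (n : ℝ)) atTop (𝓝 1) := by
      simpa using (tendsto_const_nhds (x := (1 : ℝ))).sub tendsto_one_div_atTop_nhds_zero_nat
    have h2 := h1.mul (hb.comp (tendsto_sub_atTop_nat 1))
    rw [one_mul] at h2
    refine h2.congr' ?_
    filter_upwards [eventually_gt_atTop 0] with n hn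
    have hn0 : (n : ℝ) ≠ 0 := by positivity
    rw [Nat.cast_sub (by omega : 1 ≤ n)]
    simp only [Function.comp_apply, Nat.cast_one]
    field_simp
  refine tendsto_of_tendsto_of_tendsto_of_le_of_le' (hlow.comp hcount) (hb.comp hcount) ?_ ?_
  · filter_upwards [hcount.eventually_gt_atTop 0, eventually_gt_atTop 0] with t hn ht
    have hlt : quot M (count M t - 1) < t := quot_lt_of_lt_count (by omega)
    simp only [Function.comp_apply]
    rw [← h.assocFun_quot]
    have := h.monotoneOn_assocFun (h.quot_pos _) ht hlt.le
    gcongr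
  · filter_upwards [hcount.eventually_gt_atTop 0, eventually_gt_atTop 0] with t hn ht
    have := h.monotoneOn_assocFun ht (h.quot_pos _) (h.le_quot_count t)
    rw [h.assocFun_quot] at this
    simp only [Function.comp_apply]
    rw [div_le_iff₀ (by positivity), mul_comm]
    exact this

/-- With `n = count M t`, `log t = M(t) / n - β_n + log m_n`; after division by `log n` only the
last term survives. -/
theorem tendsto_log_div_log_count (h : IsAdmissible M) {w : ℝ}
    (hb : Tendsto (beta M) atTop (𝓝 w)) :
    Tendsto (fun t => Real.log t / Real.log (count M t)) atTop (𝓝 w) := by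
  have hcount := h.tendsto_count
  have hlog := tendsto_log_natCast_atTop.comp hcount
  have h1 := (((h.tendsto_assocFun_div_count hb).div_atTop hlog).sub
    ((hb.comp hcount).div_atTop hlog)).add ((h.tendsto_logQuot_div_log hb).comp hcount)
  rw [sub_zero, zero_add] at h1
  refine h1.congr' ?_
  filter_upwards [hcount.eventually_gt_atTop 0, eventually_gt_atTop 0] with t hn ht
  have hn0 : (count M t : ℝ) ≠ 0 := by positivity
  simp only [Function.comp_apply]
  rw [← sub_div, ← add_div, h.assocFun_eq_count ht, h.beta_eq_meanDiff, meanDiff,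
    ← h.log_eq_sum, logQuot]
  congr 1
  field_simp
  ring

/-- Split `log M(t) = log (M(t) / n) + log n` with `n = count M t`; the first summand stays bounded.
-/
theorem tendsto_dFun (h : IsAdmissible M) {w : ℝ} (hw : 0 < w)
    (hb : Tendsto (beta M) atTop (𝓝 w)) : Tendsto (dFun M) atTop (𝓝 (1 / w)) := by
  have hcount := h.tendsto_count
  have hlog := tendsto_log_natCast_atTop.comp hcount
  have h1 := ((((h.tendsto_assocFun_div_count hb).log hw.ne').div_atTop hlog).const_add 1).div
    (h.tendsto_log_div_log_count hb) hw.ne'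
  rw [add_zero] at h1
  refine h1.congr' ?_
  filter_upwards [hcount.eventually_gt_atTop 0, hlog.eventually_gt_atTop 0,
    h.tendsto_assocFun.eventually_gt_atTop 0, eventually_gt_atTop 1] with t hn hln hM ht
  have hlt := Real.log_pos ht
  simp only [Function.comp_apply] at hln
  simp only [Pi.div_apply, Function.comp_apply]
  rw [dFun, Real.log_div hM.ne' (by positivity)]
  field_simp
  ring

theorem dIsProximateOrder (h : IsAdmissible M) {w : ℝ} (hw : 0 < w)
    (hb : Tendsto (beta M) atTop (𝓝 w)) : DIsProximateOrder M := by
  -- The level `1`, rather than mere positivity, makes `dFun` nonnegative.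
  obtain ⟨T, hT⟩ := eventually_atTop.1 (h.tendsto_assocFun.eventually_ge_atTop 1)
  set c := max 1 T with hc
  have hc1 : 1 ≤ c := le_max_left _ _
  have hM1 : ∀ t, c < t → 1 ≤ assocFun M t := fun t ht => hT t ((le_max_right _ _).trans ht.le)
  have hM0 : ∀ t, c < t → 0 < assocFun M t := fun t ht => one_pos.trans_le (hM1 t ht)
  have hd := h.tendsto_dFun hw hb
  refine ⟨c, hc1, hM0, zero_le_one.trans hc1, h.isPiecewiseC1_dFun hc1 hM0, fun r hr => ?_,
    ⟨_, hd⟩, ?_⟩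
  · exact div_nonneg (Real.log_nonneg (hM1 r hr)) (Real.log_nonneg (hc1.trans hr.le))
  · have h1 := ((h.tendsto_assocFun_div_count hb).inv₀ hw.ne').sub hd
    rw [one_div, sub_self] at h1
    refine (h1.mono_left inf_le_left).congr' ?_
    filter_upwards [mem_inf_of_left (Ioi_mem_atTop c),
      mem_inf_of_right (mem_principal_self _)] with t ht htd
    have ht1 : 1 < t := lt_of_le_of_lt hc1 ht
    rw [h.deriv_dFun_of_differentiableAt ht1 (hM0 t ht) htd, mul_slope_mul_log _ ht1, inv_div]

/-- Adding `d(t)` to `t d'(t) log t` leaves `n / M(t) → L` on the gaps between quotients.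
Approaching `m_p` from both sides, where `M` is continuous, gives this for the left and right
indices; `p` lies between them, whence `p / M(m_p) = 1 / β_p → L` even when quotients repeat. -/
theorem tendsto_beta_of_dIsProximateOrder (h : IsAdmissible M) (hd : DIsProximateOrder M) {L : ℝ}
    (hL : 0 < L) (hlim : Tendsto (dFun M) atTop (𝓝 L)) :
    Tendsto (beta M) atTop (𝓝 (1 / L)) := by
  obtain ⟨c, hc, hM, hprox⟩ := hd
  have hsum := hprox.deriv_limit.add (hlim.mono_left inf_le_left)
  rw [zero_add] at hsum
  have hkey : Tendsto (fun p : ℕ => (p : ℝ) / assocFun M (quot M p)) atTop (𝓝 L) := by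
    rw [Metric.tendsto_nhds]
    intro ε hε
    have hev := (Metric.tendsto_nhds.1 hsum) (ε / 2) (by positivity)
    rw [eventually_inf_principal] at hev
    obtain ⟨T, hT⟩ := eventually_atTop.1 hev
    have hgap : ∀ t, max c T < t → ∀ n : ℕ, (∀ k < n, quot M k < t) → t < quot M n →
        |n / assocFun M t - L| ≤ ε / 2 := by
      intro t ht n h1 h2
      have htc : c < t := (le_max_left _ _).trans_lt ht
      have ht1 : 1 < t := hc.trans_lt htc
      have hder := h.hasDerivAt_dFun ht1 (hM t htc) h1 h2
      have := hT t ((le_max_right _ _).trans ht.le) hder.differentiableAt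
      rw [hder.deriv, mul_slope_mul_log _ ht1, sub_add_cancel, Real.dist_eq] at this
      exact this.le
    filter_upwards [h.tendsto_quot.eventually_gt_atTop (max c T)] with p hp
    have hMp : 0 < assocFun M (quot M p) := hM _ ((le_max_left _ _).trans_lt hp)
    have hcont : ∀ n : ℕ, Tendsto (fun t => |n / assocFun M t - L|) (𝓝 (quot M p))
        (𝓝 |n / assocFun M (quot M p) - L|) := fun n =>
      ((tendsto_const_nhds.div (h.continuousAt_assocFun (h.quot_pos p)) hMp.ne').sub_const L).abs
    have hleft : |count M (quot M p) / assocFun M (quot M p) - L| ≤ ε / 2 := by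
      refine le_of_tendsto ((hcont _).mono_left (nhdsWithin_le_nhds (s := Set.Iio (quot M p)))) ?_
      filter_upwards [nhdsWithin_le_nhds (eventually_gt_nhds hp), self_mem_nhdsWithin,
        nhdsWithin_le_nhds (eventually_forall_quot_lt
          (fun _ => quot_lt_of_lt_count (t := quot M p)))] with t ht1 ht2 ht3
      exact hgap t ht1 _ ht3 (lt_of_lt_of_le ht2 (h.le_quot_count _))
    obtain ⟨n, h1, h2⟩ := h.exists_quot_le_lt_quot (quot M p)
    have hright : |n / assocFun M (quot M p) - L| ≤ ε / 2 := by
      refine le_of_tendsto ((hcont _).mono_left (nhdsWithin_le_nhds (s := Set.Ioi (quot M p)))) ?_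
      filter_upwards [self_mem_nhdsWithin, nhdsWithin_le_nhds (eventually_lt_nhds h2)] with t ht1 ht2
      exact hgap t (hp.trans ht1) _ (fun k hk => (h1 k hk).trans_lt ht1) ht2
    have hcp : count M (quot M p) ≤ p := Nat.sInf_le (le_refl (quot M p))
    have hpn : p ≤ n := (not_le.1 fun hle => h2.not_ge (h.monotone_quot hle)).le
    have h3 : (count M (quot M p) : ℝ) / assocFun M (quot M p) ≤ p / assocFun M (quot M p) := by
      gcongr
    have h4 : (p : ℝ) / assocFun M (quot M p) ≤ n / assocFun M (quot M p) := by gcongr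
    rw [Real.dist_eq, abs_lt]
    rw [abs_le] at hleft hright
    constructor <;> linarith [hleft.1, hright.2]
  have hinv := hkey.inv₀ hL.ne'
  rw [one_div]
  refine hinv.congr' ?_
  filter_upwards [eventually_gt_atTop 0] with p hp
  rw [h.assocFun_quot, inv_div, mul_div_assoc, mul_comm, div_mul_cancel₀]
  positivity

/-! ### Regular variation of the quotients -/

theorem tendsto_quot_natFloor_mul_div (h : IsAdmissible M) {w : ℝ}
    (hb : Tendsto (beta M) atTop (𝓝 w)) {x : ℝ} (hx : 0 < x) :
    Tendsto (fun p : ℕ => quot M ⌊x * p⌋₊ / quot M p) atTop (𝓝 (x ^ w)) := by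
  rw [h.beta_eq_meanDiff] at hb
  have h1 := (Real.continuous_exp.tendsto _).comp
    (tendsto_natFloor_mul_sub_of_tendsto_meanDiff hb hx)
  rw [mul_comm, ← Real.rpow_def_of_pos hx] at h1
  refine h1.congr fun p => ?_
  simp only [Function.comp_apply, logQuot]
  rw [Real.exp_sub, Real.exp_log (h.quot_pos _), Real.exp_log (h.quot_pos _)]

theorem isRegularlyVaryingOfIndex (h : IsAdmissible M) {w : ℝ}
    (hb : Tendsto (beta M) atTop (𝓝 w)) : IsRegularlyVaryingOfIndex (quot M) w :=
  ⟨⟨h.quot_pos, fun x => x ^ w, fun _ hx =>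
    ⟨Real.rpow_pos_of_pos hx w, h.tendsto_quot_natFloor_mul_div hb hx⟩⟩,
    fun _ hψ x hx => tendsto_nhds_unique (hψ x hx).2 (h.tendsto_quot_natFloor_mul_div hb hx)⟩

theorem tendsto_beta_of_tendsto_mul_div (h : IsAdmissible M) {w : ℝ}
    (hd : ∀ ℓ : ℕ, 2 ≤ ℓ →
      Tendsto (fun p : ℕ => quot M (ℓ * p) / quot M p) atTop (𝓝 ((ℓ : ℝ) ^ w))) :
    Tendsto (beta M) atTop (𝓝 w) := by
  rw [h.beta_eq_meanDiff]
  refine tendsto_meanDiff_of_tendsto_mul_sub h.monotone_logQuot fun ℓ hℓ => ?_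
  rcases hℓ.eq_or_lt with rfl | hℓ2
  · simp
  · have hpos : (0 : ℝ) < ℓ := by positivity
    have h1 := (hd ℓ hℓ2).log (Real.rpow_pos_of_pos hpos w).ne'
    rw [Real.log_rpow hpos] at h1
    refine h1.congr fun p => ?_
    rw [Real.log_div (h.quot_pos _).ne' (h.quot_pos _).ne', logQuot, logQuot]

end IsAdmissible

theorem IsRegularlyVaryingOfIndex.tendsto_mul_div {s : ℕ → ℝ} {w : ℝ}
    (hs : IsRegularlyVaryingOfIndex s w) {ℓ : ℕ} (hℓ : 2 ≤ ℓ) :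
    Tendsto (fun p : ℕ => s (ℓ * p) / s p) atTop (𝓝 ((ℓ : ℝ) ^ w)) := by
  obtain ⟨⟨-, ψ, hψ⟩, hval⟩ := hs
  have hpos : (0 : ℝ) < ℓ := by positivity
  have h1 := (hψ ℓ hpos).2
  rw [hval ψ hψ ℓ hpos] at h1
  refine h1.congr fun p => ?_
  rw [← Nat.cast_mul, Nat.floor_natCast]

end ProximateOrders

theorem theorem3p5 (M : ℕ → ℝ) (hpos : ∀ p, 0 < M p) (hM0 : M 0 = 1)
    (hlc : ProximateOrders.IsLogConvex M)
    (hm : Tendsto (ProximateOrders.quot M) atTop atTop) :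
    List.TFAE [
      -- (a)
      ProximateOrders.DIsProximateOrder M ∧
        ∃ L : ℝ, 0 < L ∧ Tendsto (ProximateOrders.dFun M) atTop (𝓝 L),
      -- (b)
      ∃ L : ℝ, 0 < L ∧ Tendsto (ProximateOrders.beta M) atTop (𝓝 L),
      -- (c)
      ∃ ω : ℝ, 0 < ω ∧ ProximateOrders.IsRegularlyVaryingOfIndex (ProximateOrders.quot M) ω,
      -- (d)
      ∃ ω : ℝ, 0 < ω ∧ ∀ ℓ : ℕ, 2 ≤ ℓ →
        Tendsto (fun p : ℕ => ProximateOrders.quot M (ℓ * p) / ProximateOrders.quot M p) atTop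
          (𝓝 ((ℓ : ℝ) ^ ω))] ∧
    -- the values, once (b), hence each of the four conditions, holds
    ((∃ L : ℝ, 0 < L ∧ Tendsto (ProximateOrders.beta M) atTop (𝓝 L)) →
      ∃ w : ℝ, 0 < w ∧ ProximateOrders.omegaIndex M = (w : EReal) ∧
        (∀ L : ℝ, Tendsto (ProximateOrders.beta M) atTop (𝓝 L) ↔ L = w) ∧
        (∀ ω : ℝ, ProximateOrders.IsRegularlyVaryingOfIndex (ProximateOrders.quot M) ω ↔ ω = w) ∧
        (∀ ω : ℝ, (∀ ℓ : ℕ, 2 ≤ ℓ →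
          Tendsto (fun p : ℕ => ProximateOrders.quot M (ℓ * p) / ProximateOrders.quot M p) atTop
            (𝓝 ((ℓ : ℝ) ^ ω))) ↔ ω = w) ∧
        (∀ L : ℝ, Tendsto (ProximateOrders.dFun M) atTop (𝓝 L) ↔ L = 1 / w)) := by
  have h : ProximateOrders.IsAdmissible M := ⟨hpos, hM0, hlc, hm⟩
  constructor
  · tfae_have 1 → 2 := fun ⟨hd, L, hL, hlim⟩ =>
      ⟨1 / L, one_div_pos.2 hL, h.tendsto_beta_of_dIsProximateOrder hd hL hlim⟩
    tfae_have 2 → 1 := fun ⟨w, hw, hb⟩ =>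
      ⟨h.dIsProximateOrder hw hb, 1 / w, one_div_pos.2 hw, h.tendsto_dFun hw hb⟩
    tfae_have 2 → 3 := fun ⟨w, hw, hb⟩ => ⟨w, hw, h.isRegularlyVaryingOfIndex hb⟩
    tfae_have 3 → 4 := fun ⟨w, hw, hs⟩ => ⟨w, hw, fun _ hℓ => hs.tendsto_mul_div hℓ⟩
    tfae_have 4 → 2 := fun ⟨w, hw, hd⟩ => ⟨w, hw, h.tendsto_beta_of_tendsto_mul_div hd⟩
    tfae_finish
  · rintro ⟨w, hw, hb⟩
    have hreg := h.isRegularlyVaryingOfIndex hb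
    -- No sign of `ω` is needed: the dilation limits alone force `β → ω`, so uniqueness of limits
    -- identifies `ω` with `w`.
    have huniq : ∀ ω : ℝ, (∀ ℓ : ℕ, 2 ≤ ℓ →
        Tendsto (fun p : ℕ => ProximateOrders.quot M (ℓ * p) / ProximateOrders.quot M p) atTop
          (𝓝 ((ℓ : ℝ) ^ ω))) → ω = w := fun _ hd =>
      tendsto_nhds_unique (h.tendsto_beta_of_tendsto_mul_div hd) hb
    refine ⟨w, hw, h.omegaIndex_eq hb, fun L => ⟨fun hL => tendsto_nhds_unique hL hb, ?_⟩,
      fun ω => ⟨fun hs => huniq ω fun _ hℓ => hs.tendsto_mul_div hℓ, ?_⟩,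
      fun ω => ⟨huniq ω, ?_⟩,
      fun L => ⟨fun hL => tendsto_nhds_unique hL (h.tendsto_dFun hw hb), ?_⟩⟩
    · rintro rfl; exact hb
    · rintro rfl; exact hreg
    · rintro rfl; exact fun _ hℓ => hreg.tendsto_mul_div hℓ
    · rintro rfl; exact h.tendsto_dFun hw hb
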